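/- Conventions. Tangle diagrams are drawn in a disc with fixed endpoints NW, NE, SE, SW. $[0]$ denotes two horizontal arcs, $[\infty]$ two vertical arcs, and $[+1]$ (resp. $[-1]$) the single crossing whose overcrossing strand joins NW to SE (resp. NE to SW). $T+S$ places $S$ to the right of $T$ and joins the adjacent endpoints; $T*S$ places $S$ below $T$. For $n\in\mathbb Z$, $[n]$ is the horizontal twist with $|n|$ crossings of the type $[\operatorname{sign}(n)1]$ (for $n = 0$ the tangle $[0]$), and $\frac1{[n]}$ the vertical twist with $|n|$ crossings of the same type (for $n=0$ the tangle $[\infty]$). $\frac1T$ is obtained from $T$ by switching all crossings and rotating by $90^\circ$ counterclockwise. Two tangle diagrams are isotopic if one is obtained from the other, with the endpoints fixed, by planar isotopy and finitely many Reidemeister moves in the interior of the disc. Consider rational tangles given in twist form, that is, built from $[0]$ or $[\infty]$ by finitely many operations $T\mapsto T+[n]$, $T\mapsto [n]+T$, $T\mapsto T*\frac1{[n]}$, $T\mapsto \frac1{[n]}*T$ with $n\in\mathbb Z$, or more generally by these operations and $T\mapsto\frac1T$ (this includes every continued fraction form $[a_1]+\frac{1}{[a_2]+\cdots+\frac{1}{[a_n]}}$).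 The fraction $F(T)\in\mathbb Q\cup\{\infty\}$ of such a tangle is the value of the same expression in $\mathbb Q\cup\{\infty\}$: $F([0])=0$, $F([\infty])=\infty$, $F(T+[n])=F([n]+T)=F(T)+n$, $F(T*\frac1{[n]})=F(\frac1{[n]}*T)=F(T)*\frac1n$ and $F(\frac1T)=\frac1{F(T)}$, where $x*y=\frac{1}{\frac1x+\frac1y}$, $\frac10=\infty$, $\frac1\infty=0$ and $\infty+n=\infty$. Theorem. The fraction is an isotopy invariant of rational tangles: if $T$ and $S$ are rational tangles given as above and $T$ is isotopic to $S$, then $F(T)=F(S)$. -/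

import Mathlib

open scoped OnePoint

/-! ### Tangle diagrams as planar graphs

The four corners of the projection disc, and the four corners of a crossing, are numbered clockwise:
`0 = NW`, `1 = NE`, `2 = SE`, `3 = SW`. -/

/-- The edge-ends of a tangle diagram with set of crossings `C`: the four edge-ends `corner c i` at
each crossing `c`, and the four endpoints `bdry i` of the tangle on the boundary circle. -/
inductive Dart (C : Type) : Type
  | corner (c : C) (i : Fin 4) : Dart C
  | bdry (i : Fin 4) : Dart C

namespace Dart

/-- Relabel the crossings. -/
def map {C C' : Type} (f : C → C') : Dart C → Dart C'
  | corner c i => corner (f c) i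
  | bdry i => bdry i

/-- Go straight through a crossing. -/
def across {C : Type} : Dart C → Dart C
  | corner c i => corner c (i + 2)
  | bdry i => bdry i

/-- The counterclockwise successor around a vertex of the graph. The boundary circle, with its four
endpoints, counts as one vertex on the other side of the sphere, so its rotation is reversed. -/
def rot {C : Type} : Dart C → Dart C
  | corner c i => corner c (i + 3)
  | bdry i => bdry (i + 1)

end Dart

/-- A diagram of a tangle with four endpoints: a finite set of crossings, each of which is a copy of
the tangle `[+1]` (`sign c = true`) or `[-1]` (`sign c = false`), and edges joining the
edge-ends in pairs. -/
structure TangleDiagram where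
  /-- The crossings. -/
  Crossing : Type
  finite : Finite Crossing
  /-- The type of a crossing, relative to the numbering of its corners. -/
  sign : Crossing → Bool
  /-- The other end of an edge. -/
  edge : Dart Crossing → Dart Crossing
  edge_edge : ∀ x, edge (edge x) = x
  edge_ne : ∀ x, edge x ≠ x

namespace TangleDiagram

open Dart

/-- Whether the edge-end at corner `i` of the crossing `c` belongs to the overcrossing strand. In
`[+1]` this is the strand from `NW` to `SE`, in `[-1]` the strand from `NE` to `SW`. -/
def Over (D : TangleDiagram) (c : D.Crossing) (i : Fin 4) : Prop :=
  D.sign c = true ↔ (i = 0 ∨ i = 2)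

/-- Every component is an arc with its ends on the boundary circle: following any strand one arrives
at the boundary. -/
def NoClosedComponent (D : TangleDiagram) : Prop :=
  ∀ x, ∃ (k : ℕ) (j : Fin 4), (fun y => across (D.edge y))^[k] x = bdry j

/-- The faces of the graph (with the boundary circle shrunk to a vertex). -/
def Face (D : TangleDiagram) : Type :=
  Quot fun x y : Dart D.Crossing => y = rot (D.edge x)

/-- The diagram lies in a disc: Euler's formula `V - E + F = 2` for the graph with `n + 1` vertices
and `2 n + 2` edges (it is connected when there is no closed component). -/
def Planar (D : TangleDiagram) : Prop :=
  Nat.card D.Face = Nat.card D.Crossing + 3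

/-- Diagrams in the disc of two arcs. -/
def IsTwoArcDiagram (D : TangleDiagram) : Prop :=
  D.NoClosedComponent ∧ D.Planar

/-! ### Reidemeister moves -/

/-- The two diagrams are the same up to planar isotopy: the crossings are renamed, and the four corners
of each crossing are numbered from another start. The endpoints are fixed. -/
def Same (D D' : TangleDiagram) : Prop :=
  ∃ (f : D.Crossing ≃ D'.Crossing) (r : D.Crossing → Fin 4) (g : Dart D.Crossing → Dart D'.Crossing),
    (∀ c i, g (corner c i) = corner (f c) (i + r c)) ∧ (∀ i, g (bdry i) = bdry i) ∧
    (∀ c i, D'.Over (f c) (i + r c) ↔ D.Over c i) ∧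
    ∀ x, D'.edge (g x) = g (D.edge x)

/-- First move: `D'` arises from `D` by adding a curl, with the new crossing `c`, to the edge that
joins `x` and `D.edge x`. -/
def Reidemeister1 (D D' : TangleDiagram) : Prop :=
  ∃ (f : D.Crossing → D'.Crossing) (c : D'.Crossing) (x : Dart D.Crossing) (p : Fin 4),
    Function.Injective f ∧ (∀ d, d ∈ Set.range f ↔ d ≠ c) ∧
    (∀ d, D'.sign (f d) = D.sign d) ∧
    D'.edge (corner c p) = x.map f ∧
    D'.edge (corner c (p + 2)) = corner c (p + 3) ∧
    D'.edge (corner c (p + 1)) = (D.edge x).map f ∧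
    ∀ z, z ≠ x → z ≠ D.edge x → D'.edge (z.map f) = (D.edge z).map f

/-- Second move: `D'` arises from `D` by pushing the edge from `x` to `D.edge x` over or under another
edge, the one from `y` to `D.edge y`; both have the face in which this is done on their right. The
first edge meets the new crossing `c` first and then `d`, the second one `d` first and then `c`.
(The move is used between planar diagrams only, which forces the two edges to be on a common face.
Pushing an edge over or under itself amounts to adding two curls.) -/
def Reidemeister2 (D D' : TangleDiagram) : Prop :=
  ∃ (f : D.Crossing → D'.Crossing) (c d : D'.Crossing) (x y : Dart D.Crossing) (p q : Fin 4),
    Function.Injective f ∧ c ≠ d ∧ (∀ b, b ∈ Set.range f ↔ b ≠ c ∧ b ≠ d) ∧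
    (∀ b, D'.sign (f b) = D.sign b) ∧
    x ≠ y ∧ x ≠ D.edge y ∧
    (D'.Over c p ↔ D'.Over d q) ∧
    D'.edge (corner c p) = x.map f ∧
    D'.edge (corner c (p + 2)) = corner d q ∧
    D'.edge (corner d (q + 2)) = (D.edge x).map f ∧
    D'.edge (corner d (q + 3)) = y.map f ∧
    D'.edge (corner d (q + 1)) = corner c (p + 1) ∧
    D'.edge (corner c (p + 3)) = (D.edge y).map f ∧
    ∀ z, z ≠ x → z ≠ D.edge x → z ≠ y → z ≠ D.edge y → D'.edge (z.map f) = (D.edge z).map f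

/-- Third move: the crossings `c 0, c 1, c 2` are the corners of a triangular face, with the
edge-ends `i m` and `i m + 1` of `c m` on its boundary, and one of its three strands passes over the
two others. Each strand is pushed across the crossing of the two others. The crossings keep their
place in the numbering, and each strand meets its two crossings in the opposite order: `t` says how the
twelve edge-ends at the three crossings exchange their roles. -/
def Reidemeister3 (D D' : TangleDiagram) : Prop :=
  ∃ (f : D.Crossing ≃ D'.Crossing) (c : Fin 3 → D.Crossing) (i : Fin 3 → Fin 4)
      (t : Dart D.Crossing → Dart D.Crossing),
    (∀ b, D'.sign (f b) = D.sign b) ∧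
    Function.Injective c ∧
    (∀ m, D.edge (corner (c m) (i m)) = corner (c (m + 1)) (i (m + 1) + 1)) ∧
    (∃ m, D.Over (c m) (i m) ∧ D.Over (c (m + 1)) (i (m + 1) + 1)) ∧
    (∀ m, t (corner (c m) (i m)) = corner (c (m + 1)) (i (m + 1) + 3)) ∧
    (∀ m, t (corner (c (m + 1)) (i (m + 1) + 3)) = corner (c m) (i m)) ∧
    (∀ m, t (corner (c (m + 1)) (i (m + 1) + 1)) = corner (c m) (i m + 2)) ∧
    (∀ m, t (corner (c m) (i m + 2)) = corner (c (m + 1)) (i (m + 1) + 1)) ∧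
    (∀ b j, b ∉ Set.range c → t (corner b j) = corner b j) ∧
    (∀ j, t (bdry j) = bdry j) ∧
    ∀ x, D'.edge ((t x).map f) = (t (D.edge x)).map f

/-- One step: planar isotopy or a Reidemeister move in the interior of the disc. -/
def Step (D D' : TangleDiagram) : Prop :=
  D.IsTwoArcDiagram ∧ D'.IsTwoArcDiagram ∧
    (Same D D' ∨ Reidemeister1 D D' ∨ Reidemeister2 D D' ∨ Reidemeister3 D D')

/-- Isotopy of tangle diagrams with fixed endpoints: a finite sequence of Reidemeister moves and their
inverses. -/
def Isotopic : TangleDiagram → TangleDiagram → Prop :=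
  Relation.EqvGen Step

/-! ### Operations on tangles -/

/-- The tangle `[0]`: two horizontal arcs. -/
def zero : TangleDiagram where
  Crossing := Empty
  finite := inferInstance
  sign := fun c => c.elim
  edge
    | bdry i => bdry (![1, 0, 3, 2] i)
  edge_edge := by
    rintro (⟨⟨⟩, _⟩ | i); fin_cases i <;> rfl
  edge_ne := by
    rintro (⟨⟨⟩, _⟩ | i); fin_cases i <;> simp

/-- The tangle `[∞]`: two vertical arcs. -/
def infinity : TangleDiagram where
  Crossing := Empty
  finite := inferInstance
  sign := fun c => c.elim
  edge
    | bdry i => bdry (![3, 2, 1, 0] i)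
  edge_edge := by
    rintro (⟨⟨⟩, _⟩ | i); fin_cases i <;> rfl
  edge_ne := by
    rintro (⟨⟨⟩, _⟩ | i); fin_cases i <;> simp

/-- Where the old edge-ends go when a crossing (called `none`) is put beside a diagram at the side
between the corners `k` and `k + 1`: the two old endpoints at that side become the two near corners
`k + 3` and `k + 2` of the new crossing. -/
def addCrossingEmb {C : Type} (k : Fin 4) : Dart C → Dart (Option C)
  | corner c i => corner (some c) i
  | bdry j => if j = k then corner none (k + 3) else if j = k + 1 then corner none (k + 2) else bdry j

theorem addCrossingEmb_injective {C : Type} (k : Fin 4) :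
    Function.Injective (addCrossingEmb k : Dart C → Dart (Option C)) := by
  rintro (⟨c, i⟩ | j) (⟨c', i'⟩ | j')
  · simp [addCrossingEmb]
  · fin_cases k <;> fin_cases j' <;> simp [addCrossingEmb]
  · fin_cases k <;> fin_cases j <;> simp [addCrossingEmb]
  · fin_cases k <;> fin_cases j <;> fin_cases j' <;> simp [addCrossingEmb]

/-- The edges after a crossing is put beside a diagram at the side between the corners `k` and `k + 1`:
its far corners `k` and `k + 1` are joined to the new endpoints. -/
def addCrossingEdge {C : Type} (e : Dart C → Dart C) (k : Fin 4) : Dart (Option C) → Dart (Option C)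
  | corner (some c) i => addCrossingEmb k (e (corner c i))
  | corner none i =>
      if i = k ∨ i = k + 1 then bdry i
      else if i = k + 3 then addCrossingEmb k (e (bdry k))
      else addCrossingEmb k (e (bdry (k + 1)))
  | bdry j => if j = k ∨ j = k + 1 then corner none j else addCrossingEmb k (e (bdry j))

theorem addCrossingEdge_emb {C : Type} (e : Dart C → Dart C) (k : Fin 4) (z : Dart C) :
    addCrossingEdge e k (addCrossingEmb k z) = addCrossingEmb k (e z) := by
  rcases z with ⟨c, i⟩ | j
  · rfl
  · fin_cases k <;> fin_cases j <;> simp [addCrossingEmb, addCrossingEdge]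

/-- An edge-end is old, or it is at a new edge. -/
theorem addCrossing_cases {C : Type} (k : Fin 4) (x : Dart (Option C)) :
    (∃ z, x = addCrossingEmb k z) ∨ ∃ i, (i = k ∨ i = k + 1) ∧ (x = bdry i ∨ x = corner none i) := by
  rcases x with ⟨_ | c, i⟩ | j
  · by_cases h : i = k ∨ i = k + 1
    · exact .inr ⟨i, h, .inr rfl⟩
    · by_cases h' : i = k + 3
      · exact .inl ⟨bdry k, by simp [addCrossingEmb, h']⟩
      · refine .inl ⟨bdry (k + 1), ?_⟩
        revert h h'
        fin_cases k <;> fin_cases i <;> simp [addCrossingEmb]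
  · exact .inl ⟨corner c i, rfl⟩
  · by_cases h : j = k ∨ j = k + 1
    · exact .inr ⟨j, h, .inl rfl⟩
    · push Not at h
      exact .inl ⟨bdry j, by simp [addCrossingEmb, h.1, h.2]⟩

/-- Put the tangle `[+1]` (`s = true`) or `[-1]` (`s = false`) beside the diagram `D`, at the side
between the corners `k` and `k + 1`: top for `k = 0`, right for `k = 1`, bottom for `k = 2`, left for
`k = 3`. -/
def addCrossing (D : TangleDiagram) (k : Fin 4) (s : Bool) : TangleDiagram where
  Crossing := Option D.Crossing
  finite := have := D.finite; inferInstance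
  sign := fun c => c.elim s D.sign
  edge := addCrossingEdge D.edge k
  edge_edge := fun x => by
    rcases addCrossing_cases k x with ⟨z, rfl⟩ | ⟨i, h, rfl | rfl⟩
    · rw [addCrossingEdge_emb, addCrossingEdge_emb, D.edge_edge]
    · simp [addCrossingEdge, h]
    · simp [addCrossingEdge, h]
  edge_ne := fun x => by
    rcases addCrossing_cases k x with ⟨z, rfl⟩ | ⟨i, h, rfl | rfl⟩
    · rw [addCrossingEdge_emb]
      exact fun h => D.edge_ne z (addCrossingEmb_injective k h)
    · simp [addCrossingEdge, h]
    · simp [addCrossingEdge, h]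

/-- Add `|n|` crossings of the type of the sign of `n` at the side `k`. -/
def addTwists (D : TangleDiagram) (k : Fin 4) (n : ℤ) : TangleDiagram :=
  (fun E => E.addCrossing k (decide (0 < n)))^[n.natAbs] D

/-- Renumber the endpoints. -/
def shiftBdry {C : Type} (k : Fin 4) : Dart C → Dart C
  | corner c i => corner c i
  | bdry j => bdry (j + k)

theorem shiftBdry_shiftBdry {C : Type} (k : Fin 4) (x : Dart C) :
    shiftBdry (-k) (shiftBdry k x) = x := by
  rcases x with ⟨c, i⟩ | j
  · rfl
  · simp [shiftBdry]

/-- The inverse of a tangle: all crossings are switched and the diagram is rotated counterclockwise by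
a right angle, so that the endpoint at the corner `j + 1` moves to the corner `j`. The numbering of the
corners of the crossings is rotated along with the diagram. -/
def inverse (D : TangleDiagram) : TangleDiagram where
  Crossing := D.Crossing
  finite := D.finite
  sign := fun c => !D.sign c
  edge := fun x => shiftBdry (-1) (D.edge (shiftBdry 1 x))
  edge_edge := fun x => by
    have h := shiftBdry_shiftBdry (-1) (D.edge (shiftBdry 1 x))
    rw [neg_neg] at h
    rw [h, D.edge_edge, shiftBdry_shiftBdry]
  edge_ne := fun x h => by
    have h' := shiftBdry_shiftBdry (-1) (D.edge (shiftBdry 1 x))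
    rw [neg_neg, h] at h'
    exact D.edge_ne _ h'.symm

end TangleDiagram

/-! ### Arithmetic of fractions in `ℚ ∪ {∞}` -/

/-- Addition, with `∞ + x = x + ∞ = ∞`. -/
def fracAdd : OnePoint ℚ → OnePoint ℚ → OnePoint ℚ
  | OnePoint.some x, OnePoint.some y => OnePoint.some (x + y)
  | _, _ => ∞

/-- Inversion, with `1/0 = ∞` and `1/∞ = 0`. -/
def fracInv : OnePoint ℚ → OnePoint ℚ
  | OnePoint.some x => if x = 0 then ∞ else OnePoint.some x⁻¹
  | ∞ => OnePoint.some 0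

/-- `x * y := 1 / (1/x + 1/y)`. -/
def fracMul (x y : OnePoint ℚ) : OnePoint ℚ :=
  fracInv (fracAdd (fracInv x) (fracInv y))

/-! ### Rational tangles -/

/-- Algebraic expressions for rational tangles. Those without `inv` are the twist forms; `inv` is
used to write continued fraction forms. -/
inductive RationalTangle : Type
  /-- `[0]` -/
  | zero : RationalTangle
  /-- `[∞]` -/
  | infinity : RationalTangle
  /-- `T + [n]` -/
  | addRight (T : RationalTangle) (n : ℤ) : RationalTangle
  /-- `[n] + T` -/
  | addLeft (n : ℤ) (T : RationalTangle) : RationalTangle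
  /-- `T * 1/[n]` -/
  | mulBottom (T : RationalTangle) (n : ℤ) : RationalTangle
  /-- `1/[n] * T` -/
  | mulTop (n : ℤ) (T : RationalTangle) : RationalTangle
  /-- `1/T` -/
  | inv (T : RationalTangle) : RationalTangle

namespace RationalTangle

/-- The tangle diagram that an expression describes. -/
def diagram : RationalTangle → TangleDiagram
  | zero => TangleDiagram.zero
  | infinity => TangleDiagram.infinity
  | addRight T n => T.diagram.addTwists 1 n
  | addLeft n T => T.diagram.addTwists 3 n
  | mulBottom T n => T.diagram.addTwists 2 n
  | mulTop n T => T.diagram.addTwists 0 n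
  | inv T => T.diagram.inverse

/-- The fraction: the same expression evaluated in `ℚ ∪ {∞}`. -/
def fraction : RationalTangle → OnePoint ℚ
  | zero => OnePoint.some 0
  | infinity => ∞
  | addRight T n => fracAdd T.fraction (OnePoint.some (n : ℚ))
  | addLeft n T => fracAdd (OnePoint.some (n : ℚ)) T.fraction
  | mulBottom T n => fracMul T.fraction (fracInv (OnePoint.some (n : ℚ)))
  | mulTop n T => fracMul (fracInv (OnePoint.some (n : ℚ))) T.fraction
  | inv T => fracInv T.fraction

end RationalTangle

namespace TangleDiagram

open Dart

/-! ### Colorings -/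

/-! The proof uses rational Fox colorings: along an undercrossing strand the color is reflected in
the color of the strand above it. The set of color quadruples at the four endpoints is an isotopy
invariant, because under each Reidemeister move a coloring outside the move extends across it on one
side exactly when it does on the other (`Isotopic.boundaryColors_eq`).

For a rational tangle this set is a linear space from which the fraction can be read. With colors `v
0, v 1, v 2, v 3` at NW, NE, SE, SW it is given by `v 0 + v 2 = v 1 + v 3` and `v 1 - v 0 = F * (v 1
- v 2)`, the latter read as `v 1 = v 2` when `F = ∞` (`RationalTangle.boundaryColors_diagram`). The
proof is by induction: a crossing at the left or right keeps `v 1 - v 2` and changes `v 1 - v 0` by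
plus or minus that amount, so `F` changes by one; a crossing at the top or bottom does the same to
`1/F`. Different fractions give different spaces (`slopeColors_injective`), which finishes the
proof.

Inverting a tangle switches all crossings, so the induction needs the colorings of the mirror image
as well. Their slope is `-F`; the parameter `m` treats both kinds at once. -/

/-- A coloring of the edges of a diagram by rational numbers: the color of an overcrossing strand is
constant and is the mean of the two colors of the undercrossing strand. For `m = false` the
overcrossing and undercrossing strands exchange their roles, so that these are the colorings of the
mirror image. -/
structure IsColoring (m : Bool) (D : TangleDiagram) (col : Dart D.Crossing → ℚ) : Prop where
  edge : ∀ x, col (D.edge x) = col x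
  straight : ∀ c i, (D.Over c i ↔ m = true) → col (corner c (i + 2)) = col (corner c i)
  mean : ∀ c i, (D.Over c i ↔ m = true) →
    col (corner c (i + 1)) + col (corner c (i + 3)) = 2 * col (corner c i)

/-- The values at the four endpoints of the colorings of a diagram. -/
def boundaryColors (m : Bool) (D : TangleDiagram) : Set (Fin 4 → ℚ) :=
  {v | ∃ col, IsColoring m D col ∧ ∀ i, col (bdry i) = v i}

theorem over_add_one (D : TangleDiagram) (c : D.Crossing) (i : Fin 4) :
    D.Over c (i + 1) ↔ ¬ D.Over c i := by
  unfold Over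
  fin_cases i <;> simp

theorem over_add_two (D : TangleDiagram) (c : D.Crossing) (i : Fin 4) :
    D.Over c (i + 2) ↔ D.Over c i := by
  unfold Over
  fin_cases i <;> simp

theorem fin_four_eq_add (p j : Fin 4) : j = p ∨ j = p + 1 ∨ j = p + 2 ∨ j = p + 3 := by
  revert p j; decide

theorem fin_four_add_add (p : Fin 4) :
    p + 1 + 1 = p + 2 ∧ p + 1 + 2 = p + 3 ∧ p + 1 + 3 = p ∧ p + 2 + 1 = p + 3 ∧ p + 2 + 2 = p ∧
      p + 2 + 3 = p + 1 ∧ p + 3 + 1 = p ∧ p + 3 + 2 = p + 1 ∧ p + 3 + 3 = p + 2 := by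
  revert p; decide

/-- The rule for the four colors `a, b, a', b'` around a crossing, where the strand with the colors
`a` and `a'` is above if `o` holds. -/
def CrossingRule (o : Prop) (a b a' b' : ℚ) : Prop :=
  (o → a' = a ∧ b + b' = 2 * a) ∧ (¬ o → b' = b ∧ a + a' = 2 * b)

/-- It suffices to test the coloring rule at each crossing in one numbering of the corners. -/
theorem isColoring_iff {m : Bool} {D : TangleDiagram} {col : Dart D.Crossing → ℚ}
    (p : D.Crossing → Fin 4) :
    IsColoring m D col ↔ (∀ x, col (D.edge x) = col x) ∧
      ∀ c, CrossingRule (D.Over c (p c) ↔ m = true) (col (corner c (p c))) (col (corner c (p c + 1)))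
        (col (corner c (p c + 2))) (col (corner c (p c + 3))) := by
  constructor
  · intro h
    refine ⟨h.edge, fun c => ⟨fun o => ⟨h.straight c _ o, h.mean c _ o⟩, fun o => ?_⟩⟩
    have o' : D.Over c (p c + 1) ↔ m = true := by rw [over_add_one]; tauto
    have h₁ := h.straight c _ o'
    have h₂ := h.mean c _ o'
    simp only [fin_four_add_add] at h₁ h₂
    exact ⟨h₁, by linarith⟩
  · rintro ⟨h, hc⟩
    -- A half turn preserves the rule because the upper strand has the same color at both ends. A
    -- quarter turn exchanges the two strands, hence the two clauses of `CrossingRule`.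
    have key : ∀ c i, (D.Over c i ↔ m = true) → col (corner c (i + 2)) = col (corner c i) ∧
        col (corner c (i + 1)) + col (corner c (i + 3)) = 2 * col (corner c i) := by
      intro c i o
      obtain ⟨h₁, h₂⟩ := hc c
      have e₁ := over_add_one D c (p c)
      have e₂ := over_add_two D c (p c)
      have e₃ := over_add_one D c (p c + 2)
      rw [(fin_four_add_add (p c)).2.2.2.1] at e₃
      rcases fin_four_eq_add (p c) i with rfl | rfl | rfl | rfl
      · exact h₁ o
      all_goals simp only [fin_four_add_add]
      · have := h₂ (by tauto)
        exact ⟨this.1, by linarith⟩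
      · have := h₁ (by tauto)
        exact ⟨this.1.symm, by linarith⟩
      · have := h₂ (by tauto)
        exact ⟨this.1.symm, by linarith⟩
    exact ⟨h, fun c i o => (key c i o).1, fun c i o => (key c i o).2⟩

/-! ### Invariance under Reidemeister moves -/

theorem over_congr_of_sign {D D' : TangleDiagram} {f : D.Crossing → D'.Crossing}
    (hs : ∀ b, D'.sign (f b) = D.sign b) (b : D.Crossing) (i : Fin 4) :
    D'.Over (f b) i ↔ D.Over b i := by
  simp [Over, hs]

theorem Same.boundaryColors_eq {D D' : TangleDiagram} (h : Same D D') (m : Bool) :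
    boundaryColors m D = boundaryColors m D' := by
  obtain ⟨f, r, g, hg, hb, ho, he⟩ := h
  ext v
  constructor
  · rintro ⟨col, h, hv⟩
    let col' : Dart D'.Crossing → ℚ
      | corner d j => col (corner (f.symm d) (j - r (f.symm d)))
      | bdry j => col (bdry j)
    have hcol : ∀ x, col' (g x) = col x := by
      rintro (⟨c, i⟩ | i)
      · simp [hg, col']
      · simp [hb, col']
    have hsurj : Function.Surjective g := by
      rintro (⟨d, j⟩ | j)
      · exact ⟨corner (f.symm d) (j - r (f.symm d)), by simp [hg]⟩
      · exact ⟨bdry j, hb j⟩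
    -- At `f c` the rule is tested from the corner `r c`, the image of corner `0` of `c`.
    refine ⟨col', (isColoring_iff fun d => r (f.symm d)).2 ⟨fun x => ?_, fun d => ?_⟩, hv⟩
    · obtain ⟨x, rfl⟩ := hsurj x
      rw [he, hcol, hcol, h.edge]
    · obtain ⟨c, rfl⟩ := f.surjective d
      have h₀ := ho c 0
      have h₁ := ((isColoring_iff fun _ => 0).1 h).2 c
      rw [zero_add] at h₀
      simpa [h₀, col'] using h₁
  · rintro ⟨col, h, hv⟩
    refine ⟨fun x => col (g x), (isColoring_iff fun _ => 0).2 ⟨fun x => ?_, fun c => ?_⟩, ?_⟩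
    · simp only [← he, h.edge]
    · have h₁ := ((isColoring_iff fun d => r (f.symm d)).1 h).2 (f c)
      have h₀ := ho c 0
      rw [zero_add] at h₀
      simpa [h₀, hg, add_comm] using h₁
    · simpa [hb] using hv

/-- A function on the edge-ends after new crossings were added: `col` at the old edge-ends, `new` at
the new crossings. -/
noncomputable def extendColors {C C' : Type} (f : C → C') (col : Dart C → ℚ)
    (new : C' → Fin 4 → ℚ) : Dart C' → ℚ
  | corner d j => Function.extend f (fun b i => col (corner b i)) new d j
  | bdry j => col (bdry j)

theorem extendColors_map {C C' : Type} {f : C → C'} (hf : Function.Injective f)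
    (col : Dart C → ℚ) (new : C' → Fin 4 → ℚ) (z : Dart C) :
    extendColors f col new (z.map f) = col z := by
  rcases z with ⟨b, i⟩ | i
  · simp [extendColors, Dart.map, hf.extend_apply]
  · rfl

theorem extendColors_corner {C C' : Type} {f : C → C'}
    (col : Dart C → ℚ) (new : C' → Fin 4 → ℚ) {d : C'} (hd : d ∉ Set.range f) (j : Fin 4) :
    extendColors f col new (corner d j) = new d j := by
  simp only [extendColors]
  rw [Function.extend_apply' _ _ _ (by simpa using hd)]

theorem CrossingRule.of_eq {o : Prop} {a b a' b' : ℚ} {c d c' d' : ℚ}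
    (h : CrossingRule o a b a' b') (h₁ : c = a) (h₂ : d = b) (h₃ : c' = a') (h₄ : d' = b') :
    CrossingRule o c d c' d' := by
  subst_vars; exact h

/-- The loop of the curl gives two neighboring corners the same color, and the rule then makes all
four corners equal. So the curl is monochromatic and does not interrupt the color of the edge. -/
theorem Reidemeister1.boundaryColors_eq {D D' : TangleDiagram} (h : Reidemeister1 D D') (m : Bool) :
    boundaryColors m D = boundaryColors m D' := by
  obtain ⟨f, c, x, p, hf, hr, hs, e₁, e₂, e₃, he⟩ := h
  have hc : c ∉ Set.range f := fun h => (hr c).1 h rfl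
  have e₁' : D'.edge (x.map f) = corner c p := by rw [← e₁, D'.edge_edge]
  have e₂' : D'.edge (corner c (p + 3)) = corner c (p + 2) := by rw [← e₂, D'.edge_edge]
  have e₃' : D'.edge ((D.edge x).map f) = corner c (p + 1) := by rw [← e₃, D'.edge_edge]
  ext v
  constructor
  · rintro ⟨col, h, hv⟩
    have hmap := extendColors_map hf col (fun _ _ => col x)
    have hnew := extendColors_corner col (fun _ _ => col x) hc
    refine ⟨extendColors f col fun _ _ => col x,
      (isColoring_iff fun _ => 0).2 ⟨?_, fun d => ?_⟩, hv⟩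
    · have hold : ∀ z : Dart D.Crossing, extendColors f col (fun _ _ => col x) (D'.edge (z.map f)) =
          extendColors f col (fun _ _ => col x) (z.map f) := by
        intro z
        by_cases h₁ : z = x
        · rw [h₁, e₁', hnew, hmap]
        by_cases h₂ : z = D.edge x
        · rw [h₂, e₃', hnew, hmap, h.edge]
        rw [he z h₁ h₂, hmap, hmap, h.edge]
      rintro (⟨d, j⟩ | j)
      · by_cases hd : d = c
        · subst hd
          rcases fin_four_eq_add p j with rfl | rfl | rfl | rfl
          · rw [e₁, hnew, hmap]
          · rw [e₃, hnew, hmap, h.edge]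
          · rw [e₂, hnew, hnew]
          · rw [e₂', hnew, hnew]
        · obtain ⟨b, rfl⟩ := (hr d).2 hd
          exact hold (corner b j)
      · exact hold (bdry j)
    · by_cases hd : d = c
      · subst hd
        simp only [hnew, CrossingRule]
        exact ⟨fun _ => ⟨trivial, by ring⟩, fun _ => ⟨trivial, by ring⟩⟩
      · obtain ⟨b, rfl⟩ := (hr d).2 hd
        rw [over_congr_of_sign hs]
        exact (((isColoring_iff fun _ => 0).1 h).2 b).of_eq (hmap (corner b _)) (hmap (corner b _))
          (hmap (corner b _)) (hmap (corner b _))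
  · rintro ⟨col, h, hv⟩
    refine ⟨fun z => col (z.map f), (isColoring_iff fun _ => 0).2 ⟨fun z => ?_, fun b => ?_⟩, hv⟩
    · have hx : col ((D.edge x).map f) = col (x.map f) := by
        rw [← e₁, ← e₃, h.edge, h.edge]
        have h₂ := h.edge (corner c (p + 2))
        rw [e₂] at h₂
        obtain ⟨k₁, k₂⟩ := ((isColoring_iff fun _ => p).1 h).2 c
        by_cases o : D'.Over c p ↔ m = true
        · have := k₁ o
          linarith
        · have := k₂ o
          linarith
      by_cases h₁ : z = x
      · rw [h₁, hx]
      by_cases h₂ : z = D.edge x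
      · rw [h₂, hx, D.edge_edge]
      rw [← he z h₁ h₂, h.edge]
    · have := ((isColoring_iff fun _ => 0).1 h).2 (f b)
      rwa [over_congr_of_sign hs] at this

/-- The lower edge is reflected twice in the color of the same upper edge, so it leaves with the
color with which it entered. -/
theorem Reidemeister2.boundaryColors_eq {D D' : TangleDiagram} (h : Reidemeister2 D D') (m : Bool) :
    boundaryColors m D = boundaryColors m D' := by
  obtain ⟨f, c, d, x, y, p, q, hf, hcd, hr, hs, hxy, hxy', ho, e₁, e₂, e₃, e₄, e₅, e₆, he⟩ := h
  have hc : c ∉ Set.range f := fun h => ((hr c).1 h).1 rfl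
  have hd : d ∉ Set.range f := fun h => ((hr d).1 h).2 rfl
  have e₁' : D'.edge (x.map f) = corner c p := by rw [← e₁, D'.edge_edge]
  have e₂' : D'.edge (corner d q) = corner c (p + 2) := by rw [← e₂, D'.edge_edge]
  have e₃' : D'.edge ((D.edge x).map f) = corner d (q + 2) := by rw [← e₃, D'.edge_edge]
  have e₄' : D'.edge (y.map f) = corner d (q + 3) := by rw [← e₄, D'.edge_edge]
  have e₅' : D'.edge (corner c (p + 1)) = corner d (q + 1) := by rw [← e₅, D'.edge_edge]
  have e₆' : D'.edge ((D.edge y).map f) = corner c (p + 3) := by rw [← e₆, D'.edge_edge]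
  ext v
  constructor
  · rintro ⟨col, h, hv⟩
    -- `a` and `b` are the colors, between the two new crossings, of the edges of `x` and `y`:
    -- unchanged on the upper edge, reflected in its color on the lower one.
    obtain ⟨a, b, hab⟩ : ∃ a b, CrossingRule (D'.Over c p ↔ m = true) (col x) b a (col y) := by
      by_cases o : D'.Over c p ↔ m = true
      · exact ⟨col x, 2 * col x - col y, fun _ => ⟨rfl, by ring⟩, fun h => (h o).elim⟩
      · exact ⟨2 * col y - col x, col y, fun h => (o h).elim, fun _ => ⟨rfl, by ring⟩⟩
    classical
    let new : D'.Crossing → Fin 4 → ℚ := fun b' j =>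
      if b' = c then ![col x, b, a, col y] (j - p) else ![a, b, col x, col y] (j - q)
    have hmap := extendColors_map hf col new
    have hnc := extendColors_corner col new hc
    have hnd := extendColors_corner col new hd
    set col' := extendColors f col new
    have c₀ : col' (corner c p) = col x := by simp [hnc, new]
    have c₁ : col' (corner c (p + 1)) = b := by simp [hnc, new]
    have c₂ : col' (corner c (p + 2)) = a := by simp [hnc, new]
    have c₃ : col' (corner c (p + 3)) = col y := by simp [hnc, new]
    have d₀ : col' (corner d q) = a := by simp [hnd, new, hcd.symm]
    have d₁ : col' (corner d (q + 1)) = b := by simp [hnd, new, hcd.symm]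
    have d₂ : col' (corner d (q + 2)) = col x := by simp [hnd, new, hcd.symm]
    have d₃ : col' (corner d (q + 3)) = col y := by simp [hnd, new, hcd.symm]
    refine ⟨col', (isColoring_iff fun b' => if b' = c then p else if b' = d then q else 0).2
      ⟨?_, fun b' => ?_⟩, hv⟩
    · have hold : ∀ z : Dart D.Crossing, col' (D'.edge (z.map f)) = col' (z.map f) := by
        intro z
        by_cases h₁ : z = x
        · rw [h₁, e₁', c₀, hmap]
        by_cases h₂ : z = D.edge x
        · rw [h₂, e₃', d₂, hmap, h.edge]
        by_cases h₃ : z = y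
        · rw [h₃, e₄', d₃, hmap]
        by_cases h₄ : z = D.edge y
        · rw [h₄, e₆', c₃, hmap, h.edge]
        rw [he z h₁ h₂ h₃ h₄, hmap, hmap, h.edge]
      rintro (⟨b', j⟩ | j)
      · by_cases hbc : b' = c
        · subst hbc
          rcases fin_four_eq_add p j with rfl | rfl | rfl | rfl
          · rw [e₁, c₀, hmap]
          · rw [e₅', c₁, d₁]
          · rw [e₂, c₂, d₀]
          · rw [e₆, c₃, hmap, h.edge]
        by_cases hbd : b' = d
        · subst hbd
          rcases fin_four_eq_add q j with rfl | rfl | rfl | rfl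
          · rw [e₂', d₀, c₂]
          · rw [e₅, d₁, c₁]
          · rw [e₃, d₂, hmap, h.edge]
          · rw [e₄, d₃, hmap]
        obtain ⟨b', rfl⟩ := (hr b').2 ⟨hbc, hbd⟩
        exact hold (corner b' j)
      · exact hold (bdry j)
    · by_cases hbc : b' = c
      · subst hbc
        simpa [c₀, c₁, c₂, c₃] using hab
      by_cases hbd : b' = d
      · subst hbd
        simp only [hbc, if_false, if_true, ← ho, d₀, d₁, d₂, d₃]
        refine ⟨fun o => ?_, fun o => ?_⟩
        · obtain ⟨k₁, k₂⟩ := hab.1 o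
          exact ⟨k₁.symm, by rw [k₁, k₂]⟩
        · obtain ⟨k₁, k₂⟩ := hab.2 o
          exact ⟨k₁, by linarith⟩
      obtain ⟨b', rfl⟩ := (hr b').2 ⟨hbc, hbd⟩
      simp only [hbc, hbd, if_false]
      rw [over_congr_of_sign hs]
      exact (((isColoring_iff fun _ => 0).1 h).2 b').of_eq (hmap (corner b' _)) (hmap (corner b' _))
        (hmap (corner b' _)) (hmap (corner b' _))
  · rintro ⟨col, h, hv⟩
    refine ⟨fun z => col (z.map f), (isColoring_iff fun _ => 0).2 ⟨fun z => ?_, fun b => ?_⟩, hv⟩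
    · have key : col ((D.edge x).map f) = col (x.map f) ∧ col ((D.edge y).map f) = col (y.map f) := by
        rw [← e₁, ← e₃, ← e₄, ← e₆, h.edge, h.edge, h.edge, h.edge]
        have h₂ := h.edge (corner c (p + 2))
        have h₅ := h.edge (corner d (q + 1))
        rw [e₂] at h₂
        rw [e₅] at h₅
        obtain ⟨k₁, k₂⟩ := ((isColoring_iff fun _ => p).1 h).2 c
        obtain ⟨l₁, l₂⟩ := ((isColoring_iff fun _ => q).1 h).2 d
        rw [← ho] at l₁ l₂
        by_cases o : D'.Over c p ↔ m = true
        · have := k₁ o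
          have := l₁ o
          constructor <;> linarith
        · have := k₂ o
          have := l₂ o
          constructor <;> linarith
      by_cases h₁ : z = x
      · rw [h₁, key.1]
      by_cases h₂ : z = D.edge x
      · rw [h₂, key.1, D.edge_edge]
      by_cases h₃ : z = y
      · rw [h₃, key.2]
      by_cases h₄ : z = D.edge y
      · rw [h₄, key.2, D.edge_edge]
      rw [← he z h₁ h₂ h₃ h₄, h.edge]
    · have := ((isColoring_iff fun _ => 0).1 h).2 (f b)
      rwa [over_congr_of_sign hs] at this

/-! ### The third Reidemeister move -/

theorem map_symm_map {C C' : Type} (f : C ≃ C') (x : Dart C) : (x.map f).map f.symm = x := by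
  cases x <;> simp [Dart.map]

theorem map_map_symm {C C' : Type} (f : C ≃ C') (x : Dart C') : (x.map f.symm).map f = x := by
  cases x <;> simp [Dart.map]

theorem fin_three_eq_add_one (m : Fin 3) : m = m + 2 + 1 := by
  revert m; decide

/-- The exchange of edge-ends in a third move is an involution. -/
theorem exchange_exchange {C : Type} {c : Fin 3 → C} {i : Fin 3 → Fin 4} {t : Dart C → Dart C}
    (t₁ : ∀ m, t (corner (c m) (i m)) = corner (c (m + 1)) (i (m + 1) + 3))
    (t₂ : ∀ m, t (corner (c (m + 1)) (i (m + 1) + 3)) = corner (c m) (i m))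
    (t₃ : ∀ m, t (corner (c (m + 1)) (i (m + 1) + 1)) = corner (c m) (i m + 2))
    (t₄ : ∀ m, t (corner (c m) (i m + 2)) = corner (c (m + 1)) (i (m + 1) + 1))
    (t₅ : ∀ b j, b ∉ Set.range c → t (corner b j) = corner b j)
    (t₆ : ∀ j, t (bdry j) = bdry j) (x : Dart C) : t (t x) = x := by
  rcases x with ⟨b, j⟩ | j
  · by_cases hb : b ∈ Set.range c
    · obtain ⟨m, rfl⟩ := hb
      rcases fin_four_eq_add (i m) j with rfl | rfl | rfl | rfl
      · rw [t₁, t₂]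
      · rw [fin_three_eq_add_one m, t₃, t₄]
      · rw [t₄, t₃]
      · rw [fin_three_eq_add_one m, t₂, t₁]
    · rw [t₅ b j hb, t₅ b j hb]
  · rw [t₆, t₆]

/-- Makes one inclusion of boundary colors sufficient. After the move the triangle lies at the
opposite corners of the three crossings, hence the shift `i m + 2`. -/
theorem Reidemeister3.symm {D D' : TangleDiagram} (h : Reidemeister3 D D') : Reidemeister3 D' D := by
  obtain ⟨f, c, i, t, hs, hc, htri, ⟨m₀, ho, ho'⟩, t₁, t₂, t₃, t₄, t₅, t₆, he⟩ := h
  have tt := exchange_exchange t₁ t₂ t₃ t₄ t₅ t₆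
  refine ⟨f.symm, fun m => f (c m), fun m => i m + 2, fun z => (t (z.map f.symm)).map f,
    fun b => ?_, f.injective.comp hc, fun m => ?_, ⟨m₀, ?_, ?_⟩, fun m => ?_, fun m => ?_,
    fun m => ?_, fun m => ?_, fun b j hb => ?_, fun j => ?_, fun z => ?_⟩
  · rw [← hs, f.apply_symm_apply]
  · have := he (corner (c (m + 1)) (i (m + 1) + 1))
    rw [t₃, ← htri, D.edge_edge, t₁] at this
    simpa [fin_four_add_add, Dart.map] using this
  · rwa [over_add_two, over_congr_of_sign hs]
  · rwa [add_right_comm, over_add_two, over_congr_of_sign hs]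
  · simp [Dart.map, t₄, fin_four_add_add]
  · simp [Dart.map, t₃, fin_four_add_add]
  · simp [Dart.map, t₂, fin_four_add_add]
  · simp [Dart.map, t₁, fin_four_add_add]
  · have : f.symm b ∉ Set.range c := by
      rintro ⟨m, hm⟩
      exact hb ⟨m, by simp [hm]⟩
    simp [Dart.map, t₅ _ _ this]
  · simp [Dart.map, t₆]
  · have := he (t (z.map f.symm))
    rw [tt, map_map_symm] at this
    rw [map_symm_map, this, map_symm_map, map_symm_map, tt]

/-- The colors of the three inner edges after a third move, where the strand `0` passes over the
others. Strand `m` has the outer colors `uₘ`, `wₘ` and the inner color `eₘ`. -/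
theorem exists_inner_colors {o₀ o₁ o₂ : Prop} {u₀ u₁ u₂ e₀ e₁ e₂ w₀ w₁ w₂ : ℚ}
    (h₀ : CrossingRule o₀ e₀ e₂ u₀ w₂) (h₁ : CrossingRule o₁ e₁ e₀ u₁ w₀)
    (h₂ : CrossingRule o₂ e₂ e₁ u₂ w₁) (ho₀ : o₀) (ho₁ : ¬ o₁) :
    ∃ e₀' e₁' e₂', CrossingRule o₀ w₀ u₂ e₀' e₂' ∧ CrossingRule o₁ w₁ u₀ e₁' e₀' ∧
      CrossingRule o₂ w₂ u₁ e₂' e₁' := by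
  have k₀ := h₀.1 ho₀
  have k₁ := h₁.2 ho₁
  -- Strand `0` has the constant color `e₀`. The rules at its crossings with strands `1` and `2`
  -- force the other two values. The four colors at the remaining crossing are then the old ones
  -- reflected by `x ↦ 2 * e₀ - x`, and reflections preserve the rule.
  refine ⟨e₀, 2 * e₀ - w₁, 2 * e₀ - u₂, ⟨fun _ => ?_, fun h => (h ho₀).elim⟩,
    ⟨fun h => (ho₁ h).elim, fun _ => ?_⟩, fun o => ?_, fun o => ?_⟩
  · constructor <;> linarith
  · constructor <;> linarith
  · have := h₂.1 o
    constructor <;> linarith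
  · have := h₂.2 o
    constructor <;> linarith

/-- Strand `m` meets strand `m + 2` at crossing `m` and strand `m + 1` at crossing `m + 1`, so `ho`
says that it is above both. By cyclic symmetry it may be numbered `0`. -/
theorem exists_inner_colors_of_ne {o : Fin 3 → Prop} {u e w : Fin 3 → ℚ}
    (h : ∀ m, CrossingRule (o m) (e m) (e (m + 2)) (u m) (w (m + 2)))
    (ho : ∃ m, o m ∧ ¬ o (m + 1)) :
    ∃ e' : Fin 3 → ℚ, ∀ m, CrossingRule (o m) (w m) (u (m + 2)) (e' m) (e' (m + 2)) := by
  obtain ⟨m, h₀, h₁⟩ := ho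
  have k₀ := h 0
  have k₁ := h 1
  have k₂ := h 2
  fin_cases m
  · obtain ⟨a, b, c, ha, hb, hc⟩ := exists_inner_colors k₀ k₁ k₂ h₀ h₁
    refine ⟨![a, b, c], fun m => ?_⟩
    fin_cases m
    exacts [ha, hb, hc]
  · obtain ⟨b, c, a, hb, hc, ha⟩ := exists_inner_colors k₁ k₂ k₀ h₀ h₁
    refine ⟨![a, b, c], fun m => ?_⟩
    fin_cases m
    exacts [ha, hb, hc]
  · obtain ⟨c, a, b, hc, ha, hb⟩ := exists_inner_colors k₂ k₀ k₁ h₀ h₁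
    refine ⟨![a, b, c], fun m => ?_⟩
    fin_cases m
    exacts [ha, hb, hc]

/-- For colorings of the mirror image the top strand of the move plays the role of the bottom one.
Since `o` is not constant on the cycle of three crossings, it also drops from true to false
somewhere, and this gives a strand that plays the role of the top one. -/
theorem exists_and_not_succ {o : Fin 3 → Prop} {m : Fin 3} (h : ¬ (o m ↔ o (m + 1))) :
    ∃ m, o m ∧ ¬ o (m + 1) := by
  by_contra! hc
  have h₁ := hc m
  have h₂ := hc (m + 1)
  have h₃ := hc (m + 1 + 1)
  have h₄ : m + 1 + 1 + 1 = m := by clear h hc h₁ h₂ h₃; revert m; decide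
  rw [h₄] at h₃
  tauto

theorem Reidemeister3.boundaryColors_subset {D D' : TangleDiagram} (h : Reidemeister3 D D')
    (m : Bool) : boundaryColors m D ⊆ boundaryColors m D' := by
  obtain ⟨f, c, i, t, hs, hc, htri, ⟨m₀, ho, ho'⟩, t₁, t₂, t₃, t₄, t₅, t₆, he⟩ := h
  have tt := exchange_exchange t₁ t₂ t₃ t₄ t₅ t₆
  rintro v ⟨col, h, hv⟩
  have inner : ∀ k, col (corner (c (k + 1)) (i (k + 1) + 1)) = col (corner (c k) (i k)) := fun k => by
    rw [← htri, h.edge]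
  -- Strand `k` passes through `c k` and `c (k + 1)`, with color `u k` before them, the old inner
  -- color between them and `w k` after them. The `e` obtained here consists of the new inner
  -- colors.
  obtain ⟨e, he'⟩ := exists_inner_colors_of_ne (o := fun k => D.Over (c k) (i k) ↔ m = true)
    (u := fun k => col (corner (c k) (i k + 2))) (e := fun k => col (corner (c k) (i k)))
    (w := fun k => col (corner (c (k + 1)) (i (k + 1) + 3))) (fun k => by
      have := ((isColoring_iff (Function.extend c i 0)).1 h).2 (c k)
      rw [hc.extend_apply] at this
      refine this.of_eq rfl ?_ rfl ?_
      · rw [← inner, ← fin_three_eq_add_one]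
      · rw [← fin_three_eq_add_one])
    (exists_and_not_succ (m := m₀) (by rw [over_add_one] at ho'; tauto))
  -- The new coloring, written on the edge-ends of `D` through `f`. At `c k` the four entries are
  -- the colors from corner `i k` on, in the order of the conclusion of `exists_inner_colors_of_ne`.
  let new : Dart D.Crossing → ℚ
    | corner b j => Function.extend c (fun k j => ![col (corner (c (k + 1)) (i (k + 1) + 3)),
        col (corner (c (k + 2)) (i (k + 2) + 2)), e k, e (k + 2)] (j - i k))
        (fun b j => col (corner b j)) b j
    | bdry j => col (bdry j)
  have n₀ : ∀ k, new (corner (c k) (i k)) = col (corner (c (k + 1)) (i (k + 1) + 3)) :=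
    fun k => by simp [new, hc.extend_apply]
  have n₁ : ∀ k, new (corner (c k) (i k + 1)) = col (corner (c (k + 2)) (i (k + 2) + 2)) :=
    fun k => by simp [new, hc.extend_apply]
  have n₂ : ∀ k, new (corner (c k) (i k + 2)) = e k := fun k => by simp [new, hc.extend_apply]
  have n₃ : ∀ k, new (corner (c k) (i k + 3)) = e (k + 2) := fun k => by
    simp [new, hc.extend_apply]
  have n₄ : ∀ b j, b ∉ Set.range c → new (corner b j) = col (corner b j) := fun b j hb => by
    simp only [new]
    rw [Function.extend_apply' _ _ _ (by simpa using hb)]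
  have fin_three : ∀ k : Fin 3, k + 1 + 2 = k := by decide
  have inner_t₁ : ∀ k, new (t (corner (c k) (i k))) = e k := fun k => by
    rw [t₁, n₃, fin_three]
  have inner_t₂ : ∀ k, new (t (corner (c (k + 1)) (i (k + 1) + 1))) = e k := fun k => by
    rw [t₃, n₂]
  -- `t` moves the outer edge-ends to their new places, where they keep their old colors.
  have outer_t : ∀ x, (∀ k, x ≠ corner (c k) (i k)) →
      (∀ k, x ≠ corner (c (k + 1)) (i (k + 1) + 1)) → new (t x) = col x := by
    rintro (⟨b, j⟩ | j) h₁ h₂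
    · by_cases hb : b ∈ Set.range c
      · obtain ⟨k, rfl⟩ := hb
        rcases fin_four_eq_add (i k) j with rfl | rfl | rfl | rfl
        · exact (h₁ k rfl).elim
        · exact (h₂ (k + 2) (by rw [← fin_three_eq_add_one])).elim
        · rw [t₄, n₁, fin_three]
        · rw [fin_three_eq_add_one k, t₂, n₀]
      · rw [t₅ _ _ hb, n₄ _ _ hb]
    · rw [t₆]
  have edge_t : ∀ x, new (t (D.edge x)) = new (t x) := by
    intro x
    by_cases h₁ : ∃ k, x = corner (c k) (i k)
    · obtain ⟨k, rfl⟩ := h₁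
      rw [htri, inner_t₁, inner_t₂]
    by_cases h₂ : ∃ k, x = corner (c (k + 1)) (i (k + 1) + 1)
    · obtain ⟨k, rfl⟩ := h₂
      rw [← htri, D.edge_edge, htri, inner_t₁, inner_t₂]
    push Not at h₁ h₂
    rw [outer_t x h₁ h₂, outer_t, h.edge]
    · rintro k hk
      exact h₂ k (by rw [← htri, ← hk, D.edge_edge])
    · rintro k hk
      exact h₁ k (by rw [← D.edge_edge x, hk, ← htri, D.edge_edge])
  refine ⟨fun z => new (z.map f.symm),
    (isColoring_iff fun d => Function.extend c i 0 (f.symm d)).2 ⟨fun z => ?_, fun d => ?_⟩, hv⟩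
  · have := he (t (z.map f.symm))
    rw [tt, map_map_symm] at this
    simp only [this, map_symm_map]
    rw [edge_t, tt]
  · obtain ⟨b, rfl⟩ := f.surjective d
    rw [over_congr_of_sign hs]
    simp only [Dart.map, f.symm_apply_apply]
    by_cases hb : b ∈ Set.range c
    · obtain ⟨k, rfl⟩ := hb
      rw [hc.extend_apply]
      exact (he' k).of_eq (n₀ k) (n₁ k) (n₂ k) (n₃ k)
    · exact (((isColoring_iff fun d => Function.extend c i 0 d).1 h).2 b).of_eq (n₄ _ _ hb)
        (n₄ _ _ hb) (n₄ _ _ hb) (n₄ _ _ hb)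

theorem Isotopic.boundaryColors_eq {D D' : TangleDiagram} (h : Isotopic D D') (m : Bool) :
    boundaryColors m D = boundaryColors m D' := by
  induction h with
  | rel D D' h =>
    rcases h.2.2 with h | h | h | h
    · exact h.boundaryColors_eq m
    · exact h.boundaryColors_eq m
    · exact h.boundaryColors_eq m
    · exact (h.boundaryColors_subset m).antisymm (h.symm.boundaryColors_subset m)
  | refl => rfl
  | symm _ _ _ ih => exact ih.symm
  | trans _ _ _ _ _ ih₁ ih₂ => exact ih₁.trans ih₂

/-! ### Colorings of rational tangles -/

/-- The boundary colors before a crossing was put at the side between the corners `k` and `k + 1`,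
where the strand through the corner `k` of the new crossing is above if `o` holds. -/
def removeCrossing (k : Fin 4) (o : Bool) (v : Fin 4 → ℚ) : Fin 4 → ℚ := fun j =>
  if j = k then bif o then 2 * v k - v (k + 1) else v (k + 1)
  else if j = k + 1 then bif o then v k else 2 * v (k + 1) - v k
  else v j

/-- The colors at the two far corners of the new crossing determine those at the two near ones,
which are the old endpoints. Thus colorings of the larger diagram correspond to colorings of `D`
with suitable boundary values. -/
theorem mem_boundaryColors_addCrossing (m : Bool) (D : TangleDiagram) (k : Fin 4) (s : Bool)
    (v : Fin 4 → ℚ) : v ∈ boundaryColors m (D.addCrossing k s) ↔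
      removeCrossing k ((s == m) == decide (k = 0 ∨ k = 2)) v ∈ boundaryColors m D := by
  have hk : k + 1 ≠ k := by simp
  have fin_four : ∀ k : Fin 4, ¬ (k + 2 = k ∨ k + 2 = k + 1) ∧ ¬ (k + 3 = k ∨ k + 3 = k + 1) ∧
      k + 2 ≠ k + 3 := by decide
  obtain ⟨hk₂, hk₃, hk₂₃⟩ := fin_four k
  -- Sign `true` puts the strand through the even corners on top, and `m = false` exchanges the
  -- strands.
  have hover : ((D.addCrossing k s).Over none k ↔ m = true) ↔
      ((s == m) == decide (k = 0 ∨ k = 2)) = true := by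
    simp only [Over, addCrossing, Option.elim]
    fin_cases k <;> cases s <;> cases m <;> simp
  generalize ((s == m) == decide (k = 0 ∨ k = 2)) = o at hover
  constructor
  · rintro ⟨col, h, hv⟩
    obtain ⟨h₁, h₂⟩ := ((isColoring_iff fun _ => k).1 h).2 none
    have b₀ : col (corner none k) = v k := by
      rw [← hv, ← h.edge (bdry k)]
      simp [addCrossing, addCrossingEdge]
    have b₁ : col (corner none (k + 1)) = v (k + 1) := by
      rw [← hv, ← h.edge (bdry (k + 1))]
      simp [addCrossing, addCrossingEdge]
    rw [b₀, b₁, hover] at h₁ h₂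
    refine ⟨fun z => col (addCrossingEmb k z), (isColoring_iff fun _ => k).2
      ⟨fun z => ?_, fun c => ?_⟩, fun j => ?_⟩
    · rw [← addCrossingEdge_emb, ← h.edge (addCrossingEmb k z)]
      rfl
    · exact ((isColoring_iff fun _ => k).1 h).2 (some c)
    · simp only [addCrossingEmb, removeCrossing]
      split_ifs with h₀ h₃
      · cases o
        · exact (h₂ (by simp)).1
        · exact eq_sub_of_add_eq' (h₁ rfl).2
      · cases o
        · exact eq_sub_of_add_eq' (h₂ (by simp)).2
        · exact (h₁ rfl).1
      · exact hv j
  · rintro ⟨col, h, hv⟩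
    let col' : Dart (Option D.Crossing) → ℚ
      | corner (some c) i => col (corner c i)
      | corner none i => if i = k ∨ i = k + 1 then v i else if i = k + 3 then col (bdry k)
          else col (bdry (k + 1))
      | bdry j => v j
    have hemb : ∀ z, col' (addCrossingEmb k z) = col z := by
      rintro (⟨c, i⟩ | j)
      · rfl
      · simp only [addCrossingEmb]
        split_ifs with h₁ h₂
        · simp only [col']
          rw [if_neg hk₃, if_pos trivial, h₁]
        · simp only [col']
          rw [if_neg hk₂, if_neg hk₂₃, h₂]
        · simp [col', hv, removeCrossing, h₁, h₂]
    refine ⟨col', (isColoring_iff fun _ => k).2 ⟨fun x => ?_, fun c => ?_⟩, fun j => rfl⟩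
    · rcases addCrossing_cases k x with ⟨z, rfl⟩ | ⟨i, hi, rfl | rfl⟩
      · have := addCrossingEdge_emb D.edge k z
        simp only [addCrossing]
        rw [this, hemb, hemb, h.edge]
      · simp [addCrossing, addCrossingEdge, hi, col']
      · simp [addCrossing, addCrossingEdge, hi, col']
    · cases c with
      | some c => exact ((isColoring_iff fun _ => k).1 h).2 c
      | none =>
        have c₂ : col' (corner none (k + 2)) = col (bdry (k + 1)) := by
          simp only [col']
          rw [if_neg hk₂, if_neg hk₂₃]
        have c₃ : col' (corner none (k + 3)) = col (bdry k) := by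
          simp only [col']
          rw [if_neg hk₃, if_pos trivial]
        have c₀ : col' (corner none k) = v k := by simp [col']
        have c₁ : col' (corner none (k + 1)) = v (k + 1) := by simp [col']
        rw [hover]
        refine CrossingRule.of_eq ?_ c₀ c₁ c₂ c₃
        rw [hv, hv]
        cases o <;> simp [CrossingRule, removeCrossing, hk]

/-- The boundary colors that belong to a fraction, or to the negative fraction if `m = false`. -/
def slopeColors (m : Bool) (F : OnePoint ℚ) : Set (Fin 4 → ℚ) :=
  {v | v 0 + v 2 = v 1 + v 3 ∧ match F with
    | OnePoint.some x => v 1 - v 0 = (bif m then x else -x) * (v 1 - v 2)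
    | ∞ => v 1 = v 2}

theorem mem_slopeColors_some {m : Bool} {x : ℚ} {v : Fin 4 → ℚ} :
    v ∈ slopeColors m (OnePoint.some x) ↔
      v 0 + v 2 = v 1 + v 3 ∧ v 1 - v 0 = (bif m then x else -x) * (v 1 - v 2) :=
  Iff.rfl

theorem mem_slopeColors_infty {m : Bool} {v : Fin 4 → ℚ} :
    v ∈ slopeColors m ∞ ↔ v 0 + v 2 = v 1 + v 3 ∧ v 1 = v 2 :=
  Iff.rfl

/-! ### Arithmetic of fractions and their slopes -/

theorem fracInv_some (x : ℚ) :
    fracInv (OnePoint.some x) = if x = 0 then ∞ else OnePoint.some x⁻¹ :=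
  rfl

theorem fracInv_infty : fracInv ∞ = OnePoint.some 0 :=
  rfl

theorem fracAdd_some (x y : ℚ) :
    fracAdd (OnePoint.some x) (OnePoint.some y) = OnePoint.some (x + y) :=
  rfl

theorem fracAdd_infty (x : OnePoint ℚ) : fracAdd x ∞ = ∞ := by
  cases x using OnePoint.rec <;> rfl

theorem infty_fracAdd (x : OnePoint ℚ) : fracAdd ∞ x = ∞ := rfl

theorem fracAdd_comm (x y : OnePoint ℚ) : fracAdd x y = fracAdd y x := by
  cases x using OnePoint.rec with
  | infty => rw [infty_fracAdd, fracAdd_infty]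
  | coe x =>
    cases y using OnePoint.rec with
    | infty => rw [infty_fracAdd, fracAdd_infty]
    | coe y => exact congrArg OnePoint.some (add_comm x y)

theorem fracMul_comm (x y : OnePoint ℚ) : fracMul x y = fracMul y x := by
  rw [fracMul, fracMul, fracAdd_comm]

theorem fracInv_fracInv (x : OnePoint ℚ) : fracInv (fracInv x) = x := by
  cases x using OnePoint.rec with
  | infty => rw [fracInv_infty, fracInv_some, if_pos rfl]
  | coe x =>
    by_cases h : x = 0
    · subst h
      rw [fracInv_some, if_pos rfl, fracInv_infty]
    · rw [fracInv_some, if_neg h, fracInv_some, if_neg (inv_ne_zero h), inv_inv]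

theorem fracAdd_zero (x : OnePoint ℚ) : fracAdd x (OnePoint.some 0) = x := by
  cases x using OnePoint.rec with
  | infty => rfl
  | coe x => exact congrArg OnePoint.some (add_zero x)

theorem fracAdd_fracAdd (x : OnePoint ℚ) (y z : ℚ) :
    fracAdd (fracAdd x (OnePoint.some y)) (OnePoint.some z) = fracAdd x (OnePoint.some (y + z)) := by
  cases x using OnePoint.rec with
  | infty => rfl
  | coe x => exact congrArg OnePoint.some (add_assoc x y z)

theorem slopeColors_injective (m : Bool) : Function.Injective (slopeColors m) := by
  intro F G h
  have key : ∀ (x : ℚ) (G : OnePoint ℚ), slopeColors m (OnePoint.some x) = slopeColors m G →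
      OnePoint.some x = G := by
    intro x G h
    let y := bif m then x else -x
    -- Normalized by `v 1 = 1` and `v 2 = 0`, so that the slope is `v 1 - v 0 = y`; the last entry
    -- comes from the equality of the diagonal sums.
    have hv : ![1 - y, 1, 0, -y] ∈ slopeColors m (OnePoint.some x) := by
      rw [mem_slopeColors_some]
      constructor
      · simp; ring
      · simp [y]
    rw [h] at hv
    cases G using OnePoint.rec with
    | infty =>
      rw [mem_slopeColors_infty] at hv
      simp at hv
    | coe z =>
      rw [mem_slopeColors_some] at hv
      have := hv.2
      refine congrArg OnePoint.some ?_
      cases m <;> simpa [y] using this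
  cases F using OnePoint.rec with
  | infty =>
    cases G using OnePoint.rec with
    | infty => rfl
    | coe x => exact (key x _ h.symm).symm
  | coe x => exact key x _ h

/-- Exchanging `v 0` and `v 2` exchanges the differences `v 1 - v 0` and `v 1 - v 2`, whose ratio is
the slope, and respects the diagonal sums. -/
theorem mem_slopeColors_fracInv (m : Bool) (F : OnePoint ℚ) (v : Fin 4 → ℚ) :
    v ∈ slopeColors m (fracInv F) ↔ ![v 2, v 1, v 0, v 3] ∈ slopeColors m F := by
  have cross : ∀ a b c : ℚ, a ≠ 0 → (b = a⁻¹ * c ↔ c = a * b) := fun a b c ha => by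
    rw [eq_inv_mul_iff_mul_eq₀ ha, eq_comm]
  cases F using OnePoint.rec with
  | infty =>
    rw [fracInv_infty, mem_slopeColors_some, mem_slopeColors_infty]
    simp
    grind
  | coe x =>
    by_cases h : x = 0
    · subst h
      rw [fracInv_some, if_pos rfl, mem_slopeColors_some, mem_slopeColors_infty]
      simp
      grind
    · rw [fracInv_some, if_neg h, mem_slopeColors_some, mem_slopeColors_some]
      have := cross x (v 1 - v 0) (v 1 - v 2) h
      cases m <;> simp <;> grind

/-! ### Effect of crossings, twists and inversion on the slope -/

/-- At the right side the crossing shifts `v 1` and `v 2` by the same multiple `±(v 1 - v 2)`. At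
the left side it shifts `v 0` and `v 3` by `±(v 0 - v 3)`, which is the same quantity up to sign
because the diagonal sums agree. -/
theorem boundaryColors_addCrossing_horizontal {D : TangleDiagram} {m : Bool} {F : OnePoint ℚ}
    (h : boundaryColors m D = slopeColors m F) {k : Fin 4} (hk : k = 1 ∨ k = 3) (s : Bool) :
    boundaryColors m (D.addCrossing k s) =
      slopeColors m (fracAdd F (OnePoint.some (bif s then 1 else -1))) := by
  ext v
  rw [mem_boundaryColors_addCrossing, h]
  cases F using OnePoint.rec with
  | infty =>
    rw [infty_fracAdd, mem_slopeColors_infty, mem_slopeColors_infty]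
    rcases hk with rfl | rfl <;> cases m <;> cases s <;> simp [removeCrossing] <;> grind
  | coe x =>
    rw [fracAdd_some, mem_slopeColors_some, mem_slopeColors_some]
    rcases hk with rfl | rfl <;> cases m <;> cases s <;> simp [removeCrossing] <;> grind

/-- The horizontal computation with `v 0` and `v 2` exchanged; here `F` stands for the reciprocal of
the fraction. -/
theorem boundaryColors_addCrossing_vertical {D : TangleDiagram} {m : Bool} {F : OnePoint ℚ}
    (h : boundaryColors m D = slopeColors m (fracInv F)) {k : Fin 4} (hk : k = 0 ∨ k = 2)
    (s : Bool) : boundaryColors m (D.addCrossing k s) =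
      slopeColors m (fracInv (fracAdd F (OnePoint.some (bif s then 1 else -1)))) := by
  ext v
  rw [mem_boundaryColors_addCrossing, h, mem_slopeColors_fracInv, mem_slopeColors_fracInv]
  cases F using OnePoint.rec with
  | infty =>
    rw [infty_fracAdd, mem_slopeColors_infty, mem_slopeColors_infty]
    rcases hk with rfl | rfl <;> cases m <;> cases s <;> simp [removeCrossing] <;> grind
  | coe x =>
    rw [fracAdd_some, mem_slopeColors_some, mem_slopeColors_some]
    rcases hk with rfl | rfl <;> cases m <;> cases s <;> simp [removeCrossing] <;> grind

theorem natAbs_mul_sign (n : ℤ) :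
    (n.natAbs : ℚ) * (bif decide (0 < n) then 1 else -1) = n := by
  rcases lt_or_ge 0 n with h | h
  · have : (n.natAbs : ℤ) = n := Int.natAbs_of_nonneg h.le
    have : ((n.natAbs : ℤ) : ℚ) = n := by rw [this]
    simpa [h] using this
  -- This includes `n = 0`, where the chosen sign is `-1` but is multiplied by `0`.
  · have : (n.natAbs : ℤ) = -n := Int.ofNat_natAbs_of_nonpos h
    have : ((n.natAbs : ℤ) : ℚ) = -n := by rw [this]; push_cast; rfl
    simp only [Int.cast_natCast] at this
    simp [this, not_lt.2 h]

/-- If each crossing of sign `s` at the side `k` adds `±1` in the parameter `F` of the boundary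
colors, then `n` twists add `n`. -/
theorem boundaryColors_addTwists {m : Bool} {k : Fin 4} {B : OnePoint ℚ → Set (Fin 4 → ℚ)}
    (hB : ∀ (D : TangleDiagram) (F : OnePoint ℚ) (s : Bool), boundaryColors m D = B F →
      boundaryColors m (D.addCrossing k s) = B (fracAdd F (OnePoint.some (bif s then 1 else -1))))
    {D : TangleDiagram} {F : OnePoint ℚ} (h : boundaryColors m D = B F) (n : ℤ) :
    boundaryColors m (D.addTwists k n) = B (fracAdd F (OnePoint.some (n : ℚ))) := by
  have key : ∀ (s : Bool) (a : ℕ), boundaryColors m ((fun E => E.addCrossing k s)^[a] D) =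
      B (fracAdd F (OnePoint.some (a * (bif s then 1 else -1)))) := by
    intro s a
    induction a with
    | zero => simpa [fracAdd_zero] using h
    | succ a ih =>
      rw [Function.iterate_succ_apply', hB _ _ s ih, fracAdd_fracAdd]
      congr 3
      push_cast
      ring
  rw [addTwists, key, natAbs_mul_sign]

theorem CrossingRule.congr {o o' : Prop} {a b a' b' : ℚ} (h : CrossingRule o a b a' b')
    (ho : o ↔ o') : CrossingRule o' a b a' b' := by
  rwa [← propext ho]

theorem mem_boundaryColors_inverse (m : Bool) (D : TangleDiagram) (v : Fin 4 → ℚ) :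
    v ∈ boundaryColors m D.inverse ↔ (fun j => v (j - 1)) ∈ boundaryColors (!m) D := by
  have hover : ∀ c : D.Crossing, (D.inverse.Over c 0 ↔ m = true) ↔ (D.Over c 0 ↔ (!m) = true) := by
    intro c
    simp only [Over, inverse]
    cases D.sign c <;> cases m <;> simp
  have hs : ∀ x : Dart D.Crossing, shiftBdry 1 (shiftBdry (-1) x) = x := fun x => by
    simpa using shiftBdry_shiftBdry (-1) x
  constructor
  · rintro ⟨col, h, hv⟩
    refine ⟨fun x => col (shiftBdry (-1) x), (isColoring_iff fun _ => 0).2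
      ⟨fun x => ?_, fun c => ?_⟩, fun j => ?_⟩
    · have := h.edge (shiftBdry (-1) x)
      simp only [inverse, hs] at this
      exact this
    · have := ((isColoring_iff fun _ => 0).1 h).2 c
      exact this.congr (hover c)
    · exact (hv (j + -1)).trans (congrArg v (sub_eq_add_neg j 1).symm)
  · rintro ⟨col, h, hv⟩
    refine ⟨fun x => col (shiftBdry 1 x), (isColoring_iff fun _ => 0).2
      ⟨fun x => ?_, fun c => ?_⟩, fun j => ?_⟩
    · simp only [inverse, hs, h.edge]
    · have := ((isColoring_iff fun _ => 0).1 h).2 c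
      exact this.congr (hover c).symm
    · simpa [shiftBdry] using hv (j + 1)

/-- The quarter turn replaces a slope by its negative reciprocal, and passing from `!m` to `m`
removes the sign. -/
theorem boundaryColors_inverse {D : TangleDiagram} {m : Bool} {F : OnePoint ℚ}
    (h : boundaryColors (!m) D = slopeColors (!m) F) :
    boundaryColors m D.inverse = slopeColors m (fracInv F) := by
  ext v
  rw [mem_boundaryColors_inverse, h, mem_slopeColors_fracInv]
  have e₀ : (0 : Fin 4) - 1 = 3 := by decide
  have e₂ : (2 : Fin 4) - 1 = 1 := by decide
  have e₃ : (3 : Fin 4) - 1 = 2 := by decide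
  cases F using OnePoint.rec with
  | infty =>
    rw [mem_slopeColors_infty, mem_slopeColors_infty]
    simp [e₀, e₂, e₃]
    grind
  | coe x =>
    rw [mem_slopeColors_some, mem_slopeColors_some]
    simp [e₀, e₂, e₃]
    grind

theorem boundaryColors_zero (m : Bool) : boundaryColors m zero = slopeColors m (OnePoint.some 0) := by
  ext v
  rw [mem_slopeColors_some]
  constructor
  · rintro ⟨col, h, hv⟩
    have h₀ : v 1 = v 0 := by
      rw [← hv, ← hv]
      exact h.edge (bdry 0)
    have h₁ : v 3 = v 2 := by
      rw [← hv, ← hv]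
      exact h.edge (bdry 2)
    constructor <;> simp [h₀, h₁]
  · rintro ⟨h₁, h₂⟩
    simp at h₂
    refine ⟨fun | bdry j => v j, (isColoring_iff fun _ => 0).2 ⟨?_, nofun⟩, fun _ => rfl⟩
    rintro (⟨⟨⟩, _⟩ | j)
    fin_cases j <;> simp [zero] <;> linarith

theorem boundaryColors_infinity (m : Bool) : boundaryColors m infinity = slopeColors m ∞ := by
  ext v
  rw [mem_slopeColors_infty]
  constructor
  · rintro ⟨col, h, hv⟩
    have h₀ : v 3 = v 0 := by
      rw [← hv, ← hv]
      exact h.edge (bdry 0)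
    have h₁ : v 1 = v 2 := by
      rw [← hv, ← hv]
      exact h.edge (bdry 2)
    constructor <;> simp [h₀, h₁, add_comm]
  · rintro ⟨h₁, h₂⟩
    refine ⟨fun | bdry j => v j, (isColoring_iff fun _ => 0).2 ⟨?_, nofun⟩, fun _ => rfl⟩
    rintro (⟨⟨⟩, _⟩ | j)
    fin_cases j <;> simp [infinity] <;> linarith

end TangleDiagram

/-! ### The slope of a rational tangle is its fraction -/

open TangleDiagram in
/-- The boundary colors of a rational tangle determine its fraction. -/
theorem RationalTangle.boundaryColors_diagram (T : RationalTangle) (m : Bool) :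
    boundaryColors m T.diagram = slopeColors m T.fraction := by
  have horizontal : ∀ (m : Bool) (T : RationalTangle) (n : ℤ) (k : Fin 4), k = 1 ∨ k = 3 →
      boundaryColors m T.diagram = slopeColors m T.fraction →
      boundaryColors m (T.diagram.addTwists k n) =
        slopeColors m (fracAdd T.fraction (OnePoint.some (n : ℚ))) 
      := fun m T n k hk h =>
    boundaryColors_addTwists (B := slopeColors m)
      (fun _ _ s hF => boundaryColors_addCrossing_horizontal hF hk s) h n
  have vertical : ∀ (m : Bool) (T : RationalTangle) (n : ℤ) (k : Fin 4), k = 0 ∨ k = 2 →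
      boundaryColors m T.diagram = slopeColors m T.fraction →
      boundaryColors m (T.diagram.addTwists k n) =
        slopeColors m (fracMul T.fraction (fracInv (OnePoint.some (n : ℚ)))) 
      := fun m T n k hk h => by
    -- Since `x * (1/n) = 1 / (1/x + n)`, vertical twists add `n` to the reciprocal, which is
    -- therefore taken as the parameter.
    rw [fracMul, fracInv_fracInv]
    exact boundaryColors_addTwists (B := fun F => slopeColors m (fracInv F))
      (fun _ _ s hF => boundaryColors_addCrossing_vertical hF hk s) (by rwa [fracInv_fracInv]) n
  -- Both values of `m` are needed at once, since the case `inv` appeals to the mirror image.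
  induction T generalizing m with
  | zero => exact boundaryColors_zero m
  | infinity => exact boundaryColors_infinity m
  | addRight T n ih => exact horizontal m T n 1 (.inl rfl) (ih m)
  | addLeft n T ih =>
    rw [fraction, fracAdd_comm]
    exact horizontal m T n 3 (.inr rfl) (ih m)
  | mulBottom T n ih => exact vertical m T n 2 (.inr rfl) (ih m)
  | mulTop n T ih =>
    rw [fraction, fracMul_comm]
    exact vertical m T n 0 (.inl rfl) (ih m)
  | inv T ih => exact boundaryColors_inverse (ih (!m))

/-- The fraction is an isotopy invariant of rational tangles. -/
theorem theorem2 (T S : RationalTangle)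
    (h : TangleDiagram.Isotopic T.diagram S.diagram) :
    T.fraction = S.fraction := by
  apply TangleDiagram.slopeColors_injective true
  rw [← T.boundaryColors_diagram, ← S.boundaryColors_diagram, h.boundaryColors_eq]
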